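/- Let $A\in\mathbb C^{n,n}$, $B\in\mathbb C^{n,m}$, let $Q=Q'\in\mathbb C^{n+m,n+m}$ (where $'$ denotes the conjugate transpose), and let $\sigma(x,u)=\begin{bmatrix}x\\u\end{bmatrix}'Q\begin{bmatrix}x\\u\end{bmatrix}$ for $x\in\mathbb C^n$, $u\in\mathbb C^m$. Assume that the pair $(A,B)$ is stabilizable: there is $K\in\mathbb C^{m,n}$ such that $zI_n-A-BK$ is invertible for all $z\in\mathbb C$ with $|z|\ge 1$. Let $P=P'\in\mathbb C^{n,n}$, $C\in\mathbb C^{m,n}$, $D\in\mathbb C^{m,m}$ be such that $$\sigma(x,u)+x'Px-(Ax+Bu)'P(Ax+Bu)=|Cx+Du|^2\qquad\text{for all }x\in\mathbb C^n,\ u\in\mathbb C^m,$$ $$\det\begin{bmatrix}\lambda A-I_n&\lambda B\\ C&D\end{bmatrix}\ne 0\qquad\text{for all }\lambda\in\mathbb C,\ |\lambda|<1.$$ For $a\in\mathbb C^n$, call a pair of sequences $x:\{0,1,2,\dots\}\to\mathbb C^n$, $u:\{0,1,2,\dots\}\to\mathbb C^m$ admissible if $x(0)=a$, $x(t+1)=Ax(t)+Bu(t)$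 for all $t\ge 0$, and $\sum_{t=0}^\infty\{|x(t)|^2+|u(t)|^2\}<\infty$. Then, for every $a\in\mathbb C^n$: 1. for every admissible pair $(x,u)$ the series $\Phi(x,u)=\sum_{t=0}^\infty\sigma(x(t),u(t))$ and $\sum_{t=0}^\infty|Cx(t)+Du(t)|^2$ converge absolutely; 2. the infimum of $\Phi(x,u)$ over all admissible pairs $(x,u)$ equals $-a'Pa$ (in particular, admissible pairs exist and the infimum is finite); 3. for every sequence $(x_i,u_i)$ of admissible pairs (with the same $a$), $\sum_{t=0}^\infty|Cx_i(t)+Du_i(t)|^2\to 0$ as $i\to\infty$ if and only if $\Phi(x_i,u_i)\to -a'Pa$ as $i\to\infty$. -/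

import Mathlib

namespace KYP

open scoped Matrix

noncomputable section

/-- The squared Euclidean norm `|v|²` of a complex vector. -/
def sqNorm {k : ℕ} (v : Fin k → ℂ) : ℝ := ∑ i, ‖v i‖ ^ 2

/-- The value `v' M v` as a real number; for Hermitian `M` nothing is lost by taking the real
part, see `KYP.coe_hermForm`. -/
def hermForm {ι : Type*} [Fintype ι] (M : Matrix ι ι ℂ) (v : ι → ℂ) : ℝ :=
  (star v ⬝ᵥ (M *ᵥ v)).re

theorem coe_hermForm {ι : Type*} [Fintype ι] {M : Matrix ι ι ℂ} (hM : M.IsHermitian)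
    (v : ι → ℂ) : ((hermForm M v : ℝ) : ℂ) = star v ⬝ᵥ (M *ᵥ v) := by
  have h : (star v ⬝ᵥ (M *ᵥ v)).im = 0 := by
    simpa using hM.im_star_dotProduct_mulVec_self v
  exact Complex.ext (by simp [hermForm]) (by simp [h])

/-- The Hermitian form `σ(x,u) = [x; u]' Q [x; u]`. -/
def sigma {n m : ℕ} (Q : Matrix (Fin n ⊕ Fin m) (Fin n ⊕ Fin m) ℂ)
    (x : Fin n → ℂ) (u : Fin m → ℂ) : ℝ :=
  hermForm Q (Sum.elim x u)

/-- Discrete-time stabilizability of `(A, B)`: for some `K` the matrix `zI - A - BK` is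
invertible whenever `|z| ≥ 1`. -/
def Stabilizable {n m : ℕ} (A : Matrix (Fin n) (Fin n) ℂ) (B : Matrix (Fin n) (Fin m) ℂ) :
    Prop :=
  ∃ K : Matrix (Fin m) (Fin n) ℂ, ∀ z : ℂ, 1 ≤ ‖z‖ →
    IsUnit (z • (1 : Matrix (Fin n) (Fin n) ℂ) - A - B * K)

/-- `(P, C, D)` is a stabilizing completion of squares for `(A, B, Q)`. -/
structure StabilizingCompletion {n m : ℕ} (A : Matrix (Fin n) (Fin n) ℂ)
    (B : Matrix (Fin n) (Fin m) ℂ) (Q : Matrix (Fin n ⊕ Fin m) (Fin n ⊕ Fin m) ℂ)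
    (P : Matrix (Fin n) (Fin n) ℂ) (C : Matrix (Fin m) (Fin n) ℂ)
    (D : Matrix (Fin m) (Fin m) ℂ) : Prop where
  hermitian : P.IsHermitian
  completion : ∀ (x : Fin n → ℂ) (u : Fin m → ℂ),
    sigma Q x u + hermForm P x - hermForm P (A *ᵥ x + B *ᵥ u) = sqNorm (C *ᵥ x + D *ᵥ u)
  det_ne_zero : ∀ z : ℂ, ‖z‖ < 1 →
    (Matrix.fromBlocks (z • A - 1) (z • B) C D).det ≠ 0

/-- `(x, u)` is a finite-energy solution of `x(t+1) = A x(t) + B u(t)`, `x(0) = a`. -/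
structure Admissible {n m : ℕ} (A : Matrix (Fin n) (Fin n) ℂ) (B : Matrix (Fin n) (Fin m) ℂ)
    (a : Fin n → ℂ) (x : ℕ → Fin n → ℂ) (u : ℕ → Fin m → ℂ) : Prop where
  initial : x 0 = a
  step : ∀ t, x (t + 1) = A *ᵥ x t + B *ᵥ u t
  finite_energy : Summable fun t => sqNorm (x t) + sqNorm (u t)

/-- The cost functional `Φ(x,u) = ∑ₜ σ(x(t), u(t))`. -/
def cost {n m : ℕ} (Q : Matrix (Fin n ⊕ Fin m) (Fin n ⊕ Fin m) ℂ)
    (x : ℕ → Fin n → ℂ) (u : ℕ → Fin m → ℂ) : ℝ :=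
  ∑' t, sigma Q (x t) (u t)

/-- The sum of squares `∑ₜ |C x(t) + D u(t)|²`. -/
def residual {n m : ℕ} (C : Matrix (Fin m) (Fin n) ℂ) (D : Matrix (Fin m) (Fin m) ℂ)
    (x : ℕ → Fin n → ℂ) (u : ℕ → Fin m → ℂ) : ℝ :=
  ∑' t, sqNorm (C *ᵥ x t + D *ᵥ u t)

end

end KYP

namespace KYP

open scoped Matrix
open Filter Topology

/-! Summing the completion identity along an admissible trajectory telescopes to `cost = residual -
a'Pa` (`Admissible.hasSum_sigma`), so everything reduces to making the residual arbitrarily small.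
The determinant condition at `0` makes `D` invertible, and the feedback `u = -D⁻¹Cx` gives zero
output with closed loop `f = A - BD⁻¹C`. The condition at `1/c` confines the eigenvalues of `f` to
the closed disk; those on the unit circle may keep this feedback from being admissible.

The remedy is to use zero output for `k` steps and only then a stabilizing feedback. If `f a = c a`
and the stabilizing feedback yields output `w` from `a`, this produces `c ^ k • w` delayed by `k`.
By linearity these outputs may be averaged over `k < N`, and the average has energy at most `‖w‖₁² /
N` (`exists_energyLT_average`). Induction on the order extends this to generalized eigenvectors
(`genEigenspace_mem_energyClosure`), and these span the space. -/

section SmallSequences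

/-! ### Sequences of small energy, delays and their averages. -/

variable {E : Type*} [NormedAddCommGroup E]

theorem norm_add_sq_le_two_mul (x y : E) : ‖x + y‖ ^ 2 ≤ 2 * ‖x‖ ^ 2 + 2 * ‖y‖ ^ 2 := by
  have h := norm_add_le x y
  nlinarith [norm_nonneg (x + y), sq_nonneg (‖x‖ - ‖y‖), norm_nonneg x, norm_nonneg y]

/-- The sequence `w` is square summable, with sum of squares less than `ε`. -/
def EnergyLT (ε : ℝ) (w : ℕ → E) : Prop :=
  (Summable fun t => ‖w t‖ ^ 2) ∧ ∑' t, ‖w t‖ ^ 2 < ε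

theorem EnergyLT.zero {ε : ℝ} (hε : 0 < ε) : EnergyLT ε (0 : ℕ → E) := by
  simp [EnergyLT, summable_zero, hε]

theorem EnergyLT.add {ε δ : ℝ} {v w : ℕ → E} (hv : EnergyLT ε v) (hw : EnergyLT δ w) :
    EnergyLT (2 * ε + 2 * δ) (v + w) := by
  have hs := (hv.1.mul_left 2).add (hw.1.mul_left 2)
  have h : Summable fun t => ‖(v + w) t‖ ^ 2 :=
    hs.of_nonneg_of_le (fun t => sq_nonneg _) (fun t => norm_add_sq_le_two_mul _ _)
  refine ⟨h, (h.tsum_le_tsum (fun t => norm_add_sq_le_two_mul _ _) hs).trans_lt ?_⟩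
  rw [(hv.1.mul_left 2).tsum_add (hw.1.mul_left 2), tsum_mul_left, tsum_mul_left]
  linarith [hv.2, hw.2]

/-- Delay a sequence by one step, with initial value zero. -/
def delay (w : ℕ → E) : ℕ → E
  | 0 => 0
  | t + 1 => w t

theorem delay_sub (v w : ℕ → E) : delay (v - w) = delay v - delay w := by
  ext t; cases t <;> simp [delay]

theorem EnergyLT.delay {ε : ℝ} {w : ℕ → E} (hw : EnergyLT ε w) : EnergyLT ε (delay w) := by
  have h : Summable fun t => ‖KYP.delay w t‖ ^ 2 := (summable_nat_add_iff 1).1 hw.1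
  refine ⟨h, ?_⟩
  rw [h.tsum_eq_zero_add]
  simpa [KYP.delay] using hw.2

theorem delay_iterate_apply (k : ℕ) (w : ℕ → E) (t : ℕ) :
    delay^[k] w t = if k ≤ t then w (t - k) else 0 := by
  induction k generalizing t with
  | zero => simp
  | succ k ih =>
    rw [Function.iterate_succ_apply']
    cases t with
    | zero => simp [delay]
    | succ t => simp [delay, ih]

theorem hasSum_norm_delay_iterate {w : ℕ → E} (hw : Summable fun t => ‖w t‖) (k : ℕ) :
    HasSum (fun t => ‖delay^[k] w t‖) (∑' t, ‖w t‖) := by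
  have h : HasSum (fun t => ‖delay^[k] w (t + k)‖) (∑' t, ‖w t‖) := by
    simpa [delay_iterate_apply] using hw.hasSum
  rw [hasSum_nat_add_iff (f := fun t => ‖delay^[k] w t‖) k] at h
  rw [Finset.sum_eq_zero, add_zero] at h
  · exact h
  · intro i hi
    simp [delay_iterate_apply, Finset.mem_range.1 hi]

variable {V : Type*} [AddCommGroup V] [Module ℂ V] [NormedSpace ℂ E]

/-- The `+ 1` keeps the inequality strict when `c = 0`. -/
theorem EnergyLT.smul {ε : ℝ} {w : ℕ → E} (c : ℂ) (hw : EnergyLT ε w) :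
    EnergyLT ((‖c‖ ^ 2 + 1) * ε) (c • w) := by
  have h : (fun t => ‖(c • w) t‖ ^ 2) = fun t => ‖c‖ ^ 2 * ‖w t‖ ^ 2 := by
    ext t; simp [norm_smul, mul_pow]
  have h0 : 0 ≤ ∑' t, ‖w t‖ ^ 2 := tsum_nonneg fun t => sq_nonneg _
  refine ⟨h ▸ hw.1.mul_left _, ?_⟩
  rw [h, tsum_mul_left]
  nlinarith [hw.2, sq_nonneg ‖c‖]

/-- Averaging the delayed copies of a summable sequence makes its energy small. -/
theorem exists_energyLT_average {w : ℕ → E} (hw : Summable fun t => ‖w t‖) {c : ℂ}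
    (hc : ‖c‖ ≤ 1) {ε : ℝ} (hε : 0 < ε) :
    ∃ N : ℕ, 0 < N ∧
      EnergyLT ε ((N : ℂ)⁻¹ • ∑ k ∈ Finset.range N, delay^[k] (c ^ k • w)) := by
  set S := ∑' t, ‖w t‖ with hS
  have hS0 : 0 ≤ S := tsum_nonneg fun t => norm_nonneg _
  -- The energy of the average will be bounded by `S ^ 2 / N`.
  obtain ⟨N, hN⟩ := exists_nat_gt (S ^ 2 / ε)
  have hN0 : (0 : ℝ) < N := lt_of_le_of_lt (by positivity) hN
  refine ⟨N, by exact_mod_cast hN0, ?_⟩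
  set v := (N : ℂ)⁻¹ • ∑ k ∈ Finset.range N, delay^[k] (c ^ k • w) with hv
  have hle : ∀ t, ‖v t‖ ≤ (N : ℝ)⁻¹ * ∑ k ∈ Finset.range N, ‖delay^[k] w t‖ := by
    intro t
    rw [hv, Pi.smul_apply, norm_smul, Finset.sum_apply]
    simp only [norm_inv, Complex.norm_natCast]
    gcongr
    refine (norm_sum_le _ _).trans (Finset.sum_le_sum fun k _ => ?_)
    rw [delay_iterate_apply, delay_iterate_apply]
    split_ifs
    · rw [Pi.smul_apply, norm_smul, norm_pow]
      exact mul_le_of_le_one_left (norm_nonneg _) (pow_le_one₀ (norm_nonneg _) hc)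
    · simp
  have hsum : HasSum (fun t => (N : ℝ)⁻¹ * ∑ k ∈ Finset.range N, ‖delay^[k] w t‖) S := by
    have := (hasSum_sum (s := Finset.range N)
      (fun k _ => hasSum_norm_delay_iterate hw k)).mul_left (N : ℝ)⁻¹
    simpa [hN0.ne'] using this
  -- At a fixed time, distinct delays `k ≤ t` read distinct entries of `w`, so the sum over `k`
  -- never exceeds the full `ℓ¹` norm.
  have hpt : ∀ t, ‖v t‖ ≤ (N : ℝ)⁻¹ * S := by
    intro t
    rw [hv, Pi.smul_apply, norm_smul, Finset.sum_apply]
    simp only [norm_inv, Complex.norm_natCast]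
    gcongr
    calc ‖∑ k ∈ Finset.range N, delay^[k] (c ^ k • w) t‖
        ≤ ∑ k ∈ Finset.range N, ‖delay^[k] (c ^ k • w) t‖ := norm_sum_le _ _
      _ ≤ ∑ k ∈ Finset.range N, if k ≤ t then ‖w (t - k)‖ else 0 := by
        refine Finset.sum_le_sum fun k _ => ?_
        rw [delay_iterate_apply]
        split_ifs
        · rw [Pi.smul_apply, norm_smul, norm_pow]
          exact mul_le_of_le_one_left (norm_nonneg _) (pow_le_one₀ (norm_nonneg _) hc)
        · simp
      _ = ∑ k ∈ Finset.range N with k ≤ t, ‖w (t - k)‖ := (Finset.sum_filter _ _).symm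
      _ = ∑ j ∈ (Finset.range N).filter (· ≤ t) |>.image (t - ·), ‖w j‖ := by
        rw [Finset.sum_image]
        intro x hx y hy hxy
        simp only [Finset.coe_filter, Finset.mem_range, Set.mem_ofPred_eq] at hx hy
        simp only at hxy
        omega
      _ ≤ S := hw.sum_le_tsum _ fun _ _ => norm_nonneg _
  -- Energy is at most the sup bound `S / N` times the `ℓ¹` bound `S`.
  have hsq : ∀ t, ‖v t‖ ^ 2 ≤
      (N : ℝ)⁻¹ * S * ((N : ℝ)⁻¹ * ∑ k ∈ Finset.range N, ‖delay^[k] w t‖) := fun t => by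
    rw [sq]
    exact mul_le_mul (hpt t) (hle t) (norm_nonneg _) (by positivity)
  have hs := hsum.mul_left ((N : ℝ)⁻¹ * S)
  have hsv : Summable fun t => ‖v t‖ ^ 2 :=
    hs.summable.of_nonneg_of_le (fun t => sq_nonneg _) hsq
  refine ⟨hsv, (hsv.tsum_le_tsum hsq hs.summable).trans_lt ?_⟩
  rw [hs.tsum_eq]
  rw [div_lt_iff₀ hε] at hN
  have : (N : ℝ)⁻¹ * S * S = S ^ 2 / N := by field_simp
  rw [this, div_lt_iff₀ hN0]
  linarith

/-! ### Energy closure and generalized eigenspaces. -/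

/-- The closure of a space of pairs (initial state, output) in the energy of the output. -/
def energyClosure (T : Submodule ℂ (V × (ℕ → E))) : Submodule ℂ (V × (ℕ → E)) where
  carrier := {p | ∀ ε > 0, ∃ w, (p.1, w) ∈ T ∧ EnergyLT ε (w - p.2)}
  add_mem' := by
    intro p q hp hq ε hε
    obtain ⟨v, hv, hv'⟩ := hp (ε / 4) (by positivity)
    obtain ⟨w, hw, hw'⟩ := hq (ε / 4) (by positivity)
    refine ⟨v + w, T.add_mem hv hw, ?_⟩
    convert hv'.add hw' using 1
    · ring
    · simp only [Prod.snd_add]; abel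
  zero_mem' := fun ε hε => ⟨0, T.zero_mem, by simpa using EnergyLT.zero hε⟩
  smul_mem' := by
    intro c p hp ε hε
    obtain ⟨w, hw, hw'⟩ := hp (ε / (‖c‖ ^ 2 + 1)) (by positivity)
    refine ⟨c • w, T.smul_mem c hw, ?_⟩
    convert hw'.smul c using 1
    · field_simp
    · simp [smul_sub]

theorem le_energyClosure (T : Submodule ℂ (V × (ℕ → E))) : T ≤ energyClosure T :=
  fun p hp ε hε => ⟨p.2, hp, by simpa using EnergyLT.zero hε⟩

/-- Closing twice adds nothing: two approximations compose. -/
theorem mem_energyClosure_zero {T : Submodule ℂ (V × (ℕ → E))} {a : V}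
    (h : ∀ ε > 0, ∃ w, (a, w) ∈ energyClosure T ∧ EnergyLT ε w) :
    (a, (0 : ℕ → E)) ∈ energyClosure T := by
  intro ε hε
  obtain ⟨v, hv, hv'⟩ := h (ε / 4) (by positivity)
  obtain ⟨w, hw, hw'⟩ := hv (ε / 4) (by positivity)
  refine ⟨w, hw, ?_⟩
  convert hw'.add hv' using 1
  · ring
  · simp

variable {T : Submodule ℂ (V × (ℕ → E))} {f : Module.End ℂ V}

/-- Hypothesis `hT` abstracts one step with zero output from `a` to `f a`. It survives closure
because delaying preserves energy. -/
theorem energyClosure_delay (hT : ∀ a w, (f a, w) ∈ T → (a, delay w) ∈ T) {a : V} {w : ℕ → E}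
    (h : (f a, w) ∈ energyClosure T) : (a, delay w) ∈ energyClosure T := by
  intro ε hε
  obtain ⟨v, hv, hv'⟩ := h ε hε
  exact ⟨delay v, hT a v hv, by simpa [delay_sub] using hv'.delay⟩

theorem energyClosure_delay_iterate (hT : ∀ a w, (f a, w) ∈ T → (a, delay w) ∈ T) (k : ℕ)
    {a : V} {w : ℕ → E} (h : ((f ^ k) a, w) ∈ energyClosure T) :
    (a, delay^[k] w) ∈ energyClosure T := by
  induction k generalizing a with
  | zero => simpa using h
  | succ k ih =>
    rw [Function.iterate_succ_apply']
    refine energyClosure_delay hT (ih ?_)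
    rwa [pow_succ, Module.End.mul_apply] at h

theorem genEigenspace_mem_energyClosure (hT : ∀ a w, (f a, w) ∈ T → (a, delay w) ∈ T)
    (hsum : ∀ a, ∃ w, (a, w) ∈ T ∧ Summable fun t => ‖w t‖) {c : ℂ} (hc : ‖c‖ ≤ 1) (d : ℕ) :
    ∀ a ∈ f.genEigenspace c d, (a, (0 : ℕ → E)) ∈ energyClosure T := by
  induction d with
  | zero =>
    intro a ha
    have : a = 0 := by simpa using ha
    subst this
    exact Submodule.zero_mem _
  | succ d ih =>
    intro a ha
    -- Inductively, `f^(k+1) a - c^(k+1) a = f (f^k a - c^k a) + c^k (f a - c a)`.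
    have hdiff : ∀ k : ℕ, (f ^ k) a - c ^ k • a ∈ f.genEigenspace c d := by
      intro k
      induction k with
      | zero => simp
      | succ k ihk =>
        have h1 : f ((f ^ k) a - c ^ k • a) ∈ f.genEigenspace c d :=
          f.mapsTo_genEigenspace_of_comm (Commute.refl f) c d ihk
        have h2 : f a - c • a ∈ f.genEigenspace c d := by
          rw [Module.End.mem_genEigenspace_nat, LinearMap.mem_ker] at ha ⊢
          simpa [pow_succ] using ha
        convert Submodule.add_mem _ h1 (Submodule.smul_mem _ (c ^ k) h2) using 1
        rw [map_sub, map_smul, smul_sub, smul_smul, pow_succ' f, Module.End.mul_apply, pow_succ]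
        abel
    obtain ⟨w, hw, hws⟩ := hsum a
    refine mem_energyClosure_zero fun ε hε => ?_
    obtain ⟨N, hN, hE⟩ := exists_energyLT_average hws hc hε
    refine ⟨_, ?_, hE⟩
    have hmem : ∀ k : ℕ, (a, delay^[k] (c ^ k • w)) ∈ energyClosure T := by
      intro k
      -- Split `(f^k a, c^k w)` as `(f^k a - c^k a, 0) + c^k (a, w)`; the first summand is covered
      -- by the induction hypothesis.
      refine energyClosure_delay_iterate hT k ?_
      have := Submodule.add_mem _ (ih _ (hdiff k))
        (Submodule.smul_mem _ (c ^ k) (le_energyClosure T hw))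
      simpa using this
    have hs := Submodule.smul_mem _ (N : ℂ)⁻¹
      (Submodule.sum_mem (energyClosure T) (t := Finset.range N) fun k _ => hmem k)
    convert hs using 1
    ext1
    · rw [Prod.smul_fst, Prod.fst_sum]
      have : (N : ℂ) ≠ 0 := by exact_mod_cast hN.ne'
      simp [← Nat.cast_smul_eq_nsmul ℂ, smul_smul, this]
    · rw [Prod.smul_snd, Prod.snd_sum]

/-- If all eigenvalues of `f` lie in the closed unit disk, outputs of arbitrarily small energy
are available from every initial state. -/
theorem mem_energyClosure_of_eigenvalues [FiniteDimensional ℂ V]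
    (hT : ∀ a w, (f a, w) ∈ T → (a, delay w) ∈ T)
    (hsum : ∀ a, ∃ w, (a, w) ∈ T ∧ Summable fun t => ‖w t‖)
    (hf : ∀ c, f.HasEigenvalue c → ‖c‖ ≤ 1) (a : V) :
    (a, (0 : ℕ → E)) ∈ energyClosure T := by
  suffices h : (⊤ : Submodule ℂ V) ≤ (energyClosure T).comap (LinearMap.inl ℂ V (ℕ → E)) from
    h (Submodule.mem_top (x := a))
  rw [← Module.End.iSup_maxGenEigenspace_eq_top f]
  refine iSup_le fun c b hb => ?_
  obtain ⟨d, hd⟩ := (Module.End.mem_maxGenEigenspace f c b).1 hb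
  have hd' : b ∈ f.genEigenspace c d := by
    rwa [Module.End.mem_genEigenspace_nat, LinearMap.mem_ker]
  by_cases hb0 : b = 0
  · subst hb0
    exact Submodule.zero_mem _
  have hev : f.HasEigenvalue c := by
    have h : f.HasGenEigenvalue c d :=
      fun h0 => hb0 (by simpa [h0] using hd')
    exact Module.End.hasEigenvalue_of_hasGenEigenvalue h
  exact genEigenspace_mem_energyClosure hT hsum (hf c hev) d b hd'

end SmallSequences

/-! ### Decay of powers when the spectrum lies in the open disk. -/

/-- Gelfand's formula dominates the powers eventually by a geometric series of ratio `r < 1`. -/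
theorem summable_norm_pow_of_spectrum {R : Type*} [NormedRing R] [NormedAlgebra ℂ R]
    [CompleteSpace R] (a : R) (h : ∀ z ∈ spectrum ℂ a, ‖z‖ < 1) :
    Summable fun t : ℕ => ‖a ^ t‖ := by
  have hr : spectralRadius ℂ a < 1 := by
    rcases (spectrum ℂ a).eq_empty_or_nonempty with h0 | h0
    · simp [spectralRadius, h0]
    · exact_mod_cast spectrum.spectralRadius_lt_of_forall_lt_of_nonempty (r := 1) h0
        (fun z hz => by exact_mod_cast h z hz)
  obtain ⟨r, hr1, hr2⟩ := ENNReal.lt_iff_exists_nnreal_btwn.1 hr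
  have hlim := spectrum.pow_nnnorm_pow_one_div_tendsto_nhds_spectralRadius a
  have hr2' : r < 1 := by exact_mod_cast hr2
  refine Summable.of_norm_bounded_eventually_nat
    (summable_geometric_of_lt_one r.coe_nonneg (by exact_mod_cast hr2')) ?_
  filter_upwards [hlim.eventually (gt_mem_nhds hr1), eventually_gt_atTop 0] with t ht ht0
  have h1 : (‖a ^ t‖₊ : ENNReal) ≤ (r : ENNReal) ^ t := by
    have ht0' : (0 : ℝ) < t := by exact_mod_cast ht0
    have h2 := ENNReal.rpow_le_rpow ht.le ht0'.le
    rwa [← ENNReal.rpow_mul, one_div, inv_mul_cancel₀ ht0'.ne', ENNReal.rpow_one,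
      ENNReal.rpow_natCast] at h2
  rw [norm_norm]
  exact_mod_cast h1

theorem summable_norm_pow_mulVec {n : ℕ} (M : Matrix (Fin n) (Fin n) ℂ)
    (hM : ∀ z : ℂ, 1 ≤ ‖z‖ → IsUnit (z • (1 : Matrix (Fin n) (Fin n) ℂ) - M))
    (a : Fin n → ℂ) : Summable fun t : ℕ => ‖(M ^ t) *ᵥ a‖ := by
  let _ := Matrix.linftyOpNormedRing (n := Fin n) (α := ℂ)
  let _ := Matrix.linftyOpNormedAlgebra (n := Fin n) (R := ℂ) (α := ℂ)
  have hcs : CompleteSpace (Matrix (Fin n) (Fin n) ℂ) := FiniteDimensional.complete ℂ _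
  have h := summable_norm_pow_of_spectrum M (fun z hz => by
    by_contra hz'
    refine hz ?_
    rw [spectrum.mem_resolventSet_iff, Algebra.algebraMap_eq_smul_one]
    exact hM z (not_lt.1 hz'))
  refine (h.mul_right ‖a‖).of_nonneg_of_le (fun _ => norm_nonneg _) fun t => ?_
  exact Matrix.linfty_opNorm_mulVec _ _

/-! ### Bounds for `sqNorm` and `hermForm`. -/

theorem sqNorm_nonneg {k : ℕ} (v : Fin k → ℂ) : 0 ≤ sqNorm v :=
  Finset.sum_nonneg fun _ _ => sq_nonneg _

theorem norm_sq_le_sqNorm {k : ℕ} (v : Fin k → ℂ) (i : Fin k) : ‖v i‖ ^ 2 ≤ sqNorm v :=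
  Finset.single_le_sum (f := fun i => ‖v i‖ ^ 2) (fun _ _ => sq_nonneg _) (Finset.mem_univ i)

theorem sqNorm_le {k : ℕ} (v : Fin k → ℂ) : sqNorm v ≤ k * ‖v‖ ^ 2 := by
  have : sqNorm v ≤ ∑ _i : Fin k, ‖v‖ ^ 2 :=
    Finset.sum_le_sum fun i _ => pow_le_pow_left₀ (norm_nonneg _) (norm_le_pi_norm v i) 2
  simpa using this

theorem norm_sq_le_sqNorm_pi {k : ℕ} (v : Fin k → ℂ) : ‖v‖ ^ 2 ≤ sqNorm v := by
  have : ‖v‖ ≤ √(sqNorm v) := (pi_norm_le_iff_of_nonneg (Real.sqrt_nonneg _)).2 fun i =>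
    Real.le_sqrt_of_sq_le (norm_sq_le_sqNorm v i)
  calc ‖v‖ ^ 2 ≤ √(sqNorm v) ^ 2 := pow_le_pow_left₀ (norm_nonneg _) this 2
    _ = sqNorm v := Real.sq_sqrt (sqNorm_nonneg v)

theorem sqNorm_add_le {k : ℕ} (v w : Fin k → ℂ) :
    sqNorm (v + w) ≤ 2 * sqNorm v + 2 * sqNorm w := by
  simp only [sqNorm, Finset.mul_sum, ← Finset.sum_add_distrib]
  exact Finset.sum_le_sum fun i _ => norm_add_sq_le_two_mul _ _

theorem sqNorm_smul {k : ℕ} (c : ℂ) (v : Fin k → ℂ) : sqNorm (c • v) = ‖c‖ ^ 2 * sqNorm v := by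
  simp [sqNorm, Finset.mul_sum, mul_pow]

theorem abs_hermForm_le {k : ℕ} (M : Matrix (Fin k) (Fin k) ℂ) (v : Fin k → ℂ) :
    |hermForm M v| ≤ (∑ i, ∑ j, ‖M i j‖) * sqNorm v := by
  refine (Complex.abs_re_le_norm _).trans ?_
  simp only [dotProduct, Matrix.mulVec, Finset.sum_mul]
  refine (norm_sum_le _ _).trans (Finset.sum_le_sum fun i _ => ?_)
  rw [Finset.mul_sum]
  refine (norm_sum_le _ _).trans (Finset.sum_le_sum fun j _ => ?_)
  have h1 := norm_sq_le_sqNorm v i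
  have h2 := norm_sq_le_sqNorm v j
  simp only [Pi.star_apply, norm_mul, norm_star]
  have : ‖v i‖ * ‖v j‖ ≤ sqNorm v := by nlinarith [sq_nonneg (‖v i‖ - ‖v j‖)]
  nlinarith [norm_nonneg (M i j)]

theorem exists_sqNorm_mulVec_le {k l : ℕ} (M : Matrix (Fin k) (Fin l) ℂ) :
    ∃ c : ℝ, ∀ v, sqNorm (M *ᵥ v) ≤ c * sqNorm v := by
  refine ⟨k * ‖M.mulVecLin.toContinuousLinearMap‖ ^ 2, fun v => ?_⟩
  have h : ‖M *ᵥ v‖ ≤ _ := M.mulVecLin.toContinuousLinearMap.le_opNorm v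
  calc sqNorm (M *ᵥ v) ≤ k * ‖M *ᵥ v‖ ^ 2 := sqNorm_le _
    _ ≤ k * (‖M.mulVecLin.toContinuousLinearMap‖ * ‖v‖) ^ 2 := by gcongr
    _ = k * ‖M.mulVecLin.toContinuousLinearMap‖ ^ 2 * ‖v‖ ^ 2 := by ring
    _ ≤ _ := by gcongr; exact norm_sq_le_sqNorm_pi v

/-! ### Admissible trajectories and their outputs. -/

section Trajectories

variable {n m : ℕ} {A : Matrix (Fin n) (Fin n) ℂ} {B : Matrix (Fin n) (Fin m) ℂ}
  {Q : Matrix (Fin n ⊕ Fin m) (Fin n ⊕ Fin m) ℂ} {P : Matrix (Fin n) (Fin n) ℂ}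
  {C : Matrix (Fin m) (Fin n) ℂ} {D : Matrix (Fin m) (Fin m) ℂ} {a b : Fin n → ℂ}
  {x y : ℕ → Fin n → ℂ} {u v : ℕ → Fin m → ℂ}

theorem Admissible.summable_state (h : Admissible A B a x u) : Summable fun t => sqNorm (x t) :=
  h.finite_energy.of_nonneg_of_le (fun _ => sqNorm_nonneg _)
    fun _ => le_add_of_nonneg_right (sqNorm_nonneg _)

theorem Admissible.summable_input (h : Admissible A B a x u) : Summable fun t => sqNorm (u t) :=
  h.finite_energy.of_nonneg_of_le (fun _ => sqNorm_nonneg _)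
    fun _ => le_add_of_nonneg_left (sqNorm_nonneg _)

theorem Admissible.summable_hermForm (h : Admissible A B a x u) :
    Summable fun t => hermForm P (x t) :=
  (h.summable_state.mul_left _).of_norm_bounded fun t => abs_hermForm_le P (x t)

theorem Admissible.summable_output (h : Admissible A B a x u) :
    Summable fun t => sqNorm (C *ᵥ x t + D *ᵥ u t) := by
  obtain ⟨c, hc⟩ := exists_sqNorm_mulVec_le C
  obtain ⟨d, hd⟩ := exists_sqNorm_mulVec_le D
  refine (((h.summable_state.mul_left c).mul_left 2).add
    ((h.summable_input.mul_left d).mul_left 2)).of_nonneg_of_le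
    (fun _ => sqNorm_nonneg _) fun t => ?_
  linarith [sqNorm_add_le (C *ᵥ x t) (D *ᵥ u t), hc (x t), hd (u t)]

/-- The terms `x'Px` are summable along the trajectory, so the telescoping part contributes exactly
`-a'Pa`, with no boundary term at infinity. -/
theorem Admissible.hasSum_sigma (h : Admissible A B a x u)
    (hPCD : StabilizingCompletion A B Q P C D) :
    HasSum (fun t => sigma Q (x t) (u t)) (residual C D x u - hermForm P a) := by
  have hP := h.summable_hermForm (P := P)
  have hP' : HasSum (fun t => hermForm P (x (t + 1))) ((∑' t, hermForm P (x t)) - hermForm P a) := by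
    rw [← h.initial]
    simpa using (hasSum_nat_add_iff' 1).2 hP.hasSum
  have hs := (h.summable_output (C := C) (D := D)).hasSum.add (hP'.sub hP.hasSum)
  convert hs using 1
  · ext t
    rw [h.step t, ← hPCD.completion]
    ring
  · rw [residual]; ring

theorem Admissible.add (h : Admissible A B a x u) (h' : Admissible A B b y v) :
    Admissible A B (a + b) (x + y) (u + v) where
  initial := by simp [h.initial, h'.initial]
  step t := by
    simp only [Pi.add_apply, h.step, h'.step, Matrix.mulVec_add]
    abel
  finite_energy :=
    ((h.finite_energy.mul_left 2).add (h'.finite_energy.mul_left 2)).of_nonneg_of_le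
      (fun _ => add_nonneg (sqNorm_nonneg _) (sqNorm_nonneg _)) fun t => by
        have := sqNorm_add_le (x t) (y t)
        have := sqNorm_add_le (u t) (v t)
        simp only [Pi.add_apply]
        linarith

theorem Admissible.smul (c : ℂ) (h : Admissible A B a x u) :
    Admissible A B (c • a) (c • x) (c • u) where
  initial := by simp [h.initial]
  step t := by simp [h.step, Matrix.mulVec_smul]
  finite_energy := by simpa [sqNorm_smul, mul_add] using h.finite_energy.mul_left (‖c‖ ^ 2)

theorem Admissible.zero : Admissible A B 0 0 0 where
  initial := rfl
  step t := by simp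
  finite_energy := by simp [sqNorm, summable_zero]

/-- A trajectory may be preceded by one step with an arbitrary input. -/
theorem Admissible.cons {u₀ : Fin m → ℂ} (h : Admissible A B (A *ᵥ a + B *ᵥ u₀) x u) :
    Admissible A B a (fun t => Nat.casesOn t a x) (fun t => Nat.casesOn t u₀ u) where
  initial := rfl
  step t := by
    cases t with
    | zero => exact h.initial
    | succ t => exact h.step t
  finite_energy := (summable_nat_add_iff 1).1 h.finite_energy

variable (A B C D) in
/-- The pairs (initial state, output `C x + D u`) of admissible trajectories. -/
def outputs : Submodule ℂ ((Fin n → ℂ) × (ℕ → Fin m → ℂ)) where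
  carrier := {p | ∃ x u, Admissible A B p.1 x u ∧ p.2 = fun t => C *ᵥ x t + D *ᵥ u t}
  add_mem' := by
    rintro ⟨a, w⟩ ⟨b, w'⟩ ⟨x, u, h, rfl⟩ ⟨y, v, h', rfl⟩
    refine ⟨_, _, h.add h', ?_⟩
    ext1 t
    simp only [Prod.mk_add_mk, Pi.add_apply, Matrix.mulVec_add]
    abel
  zero_mem' := ⟨0, 0, Admissible.zero, by ext; simp⟩
  smul_mem' := by
    rintro c ⟨a, w⟩ ⟨x, u, h, rfl⟩
    refine ⟨_, _, h.smul c, ?_⟩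
    ext1 t
    simp [Matrix.mulVec_smul]

/-- The feedback `u = Kx` decays geometrically; the averaging argument needs this `ℓ¹` output, not
merely finite energy. -/
theorem Stabilizable.exists_outputs (hAB : Stabilizable A B) (a : Fin n → ℂ) :
    ∃ w, (a, w) ∈ outputs A B C D ∧ Summable fun t => ‖w t‖ := by
  obtain ⟨K, hK⟩ := hAB
  have hs := summable_norm_pow_mulVec (A + B * K) (fun z hz => by
    simpa [sub_sub] using hK z hz) a
  set x : ℕ → Fin n → ℂ := fun t => ((A + B * K) ^ t) *ᵥ a with hx
  have hx2 : Summable fun t => sqNorm (x t) := by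
    have h2 : Summable fun t => ‖x t‖ ^ 2 := by
      refine Summable.of_norm_bounded_eventually_nat hs ?_
      filter_upwards [hs.tendsto_atTop_zero.eventually (gt_mem_nhds one_pos)] with t ht
      rw [norm_pow, norm_norm]
      exact pow_le_of_le_one (norm_nonneg _) ht.le two_ne_zero
    exact (h2.mul_left (n : ℝ)).of_nonneg_of_le (fun _ => sqNorm_nonneg _) fun t => sqNorm_le _
  obtain ⟨k, hk⟩ := exists_sqNorm_mulVec_le K
  refine ⟨_, ⟨x, fun t => K *ᵥ x t, ⟨by simp [hx], fun t => ?_, ?_⟩, rfl⟩, ?_⟩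
  · simp only [hx, pow_succ', Matrix.mulVec_mulVec, ← Matrix.add_mulVec, Matrix.add_mul,
      Matrix.mul_assoc]
  · exact hx2.add ((hx2.mul_left k).of_nonneg_of_le (fun _ => sqNorm_nonneg _) fun t => hk _)
  · have hc := fun t => (C + D * K).mulVecLin.toContinuousLinearMap.le_opNorm (x t)
    refine (hs.mul_left ‖(C + D * K).mulVecLin.toContinuousLinearMap‖).of_nonneg_of_le
      (fun _ => norm_nonneg _) fun t => ?_
    simpa [Matrix.add_mulVec, Matrix.mulVec_mulVec] using hc t

/-! ### The zero-output feedback and small residuals. -/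

theorem StabilizingCompletion.isUnit_det (hPCD : StabilizingCompletion A B Q P C D) :
    IsUnit D.det := by
  have h := hPCD.det_ne_zero 0 (by simp)
  rw [zero_smul, zero_smul, Matrix.det_fromBlocks_zero₁₂] at h
  exact (right_ne_zero_of_mul h).isUnit

/-- An eigenvector `v` with `‖c‖ > 1` would put `(v, -D⁻¹Cv)` in the kernel of the block matrix at
`c⁻¹`, inside the open disk. -/
theorem StabilizingCompletion.norm_le_one_of_hasEigenvalue
    (hPCD : StabilizingCompletion A B Q P C D) (c : ℂ)
    (hc : Module.End.HasEigenvalue (A - B * D⁻¹ * C).mulVecLin c) : ‖c‖ ≤ 1 := by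
  by_contra! hc1
  obtain ⟨v, hv⟩ := hc.exists_hasEigenvector
  have hc0 : c ≠ 0 := by
    rintro rfl
    simp at hc1
    linarith
  refine hPCD.det_ne_zero c⁻¹ (by rw [norm_inv]; exact inv_lt_one_of_one_lt₀ hc1) ?_
  refine Matrix.exists_mulVec_eq_zero_iff.1 ⟨Sum.elim v (-(D⁻¹ *ᵥ (C *ᵥ v))), ?_, ?_⟩
  · intro h0
    exact hv.2 (funext fun i => congrFun h0 (Sum.inl i))
  · have hv' : A *ᵥ v - B *ᵥ (D⁻¹ *ᵥ (C *ᵥ v)) = c • v := by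
      simpa [Matrix.sub_mulVec, Matrix.mulVec_mulVec, Matrix.mul_assoc] using hv.apply_eq_smul
    have hD : D *ᵥ (D⁻¹ *ᵥ (C *ᵥ v)) = C *ᵥ v := by
      rw [Matrix.mulVec_mulVec, Matrix.mul_nonsing_inv _ hPCD.isUnit_det, Matrix.one_mulVec]
    rw [Matrix.fromBlocks_mulVec]
    have h1 : (c⁻¹ • A - 1) *ᵥ v + (c⁻¹ • B) *ᵥ (-(D⁻¹ *ᵥ (C *ᵥ v))) = 0 := by
      rw [Matrix.sub_mulVec, Matrix.one_mulVec, Matrix.smul_mulVec, Matrix.smul_mulVec,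
        Matrix.mulVec_neg, smul_neg]
      calc _ = c⁻¹ • (A *ᵥ v - B *ᵥ (D⁻¹ *ᵥ (C *ᵥ v))) - v := by rw [smul_sub]; abel
        _ = 0 := by rw [hv', smul_smul, inv_mul_cancel₀ hc0, one_smul, sub_self]
    have h2 : C *ᵥ v + D *ᵥ (-(D⁻¹ *ᵥ (C *ᵥ v))) = 0 := by
      rw [Matrix.mulVec_neg, hD, add_neg_cancel]
    ext i
    cases i with
    | inl i => simpa using congrFun h1 i
    | inr i => simpa using congrFun h2 i

/-- The first input `-D⁻¹Ca` cancels the output and moves `a` to `(A - BD⁻¹C)a`. -/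
theorem StabilizingCompletion.delay_mem_outputs (hPCD : StabilizingCompletion A B Q P C D)
    (a : Fin n → ℂ) (w : ℕ → Fin m → ℂ)
    (h : ((A - B * D⁻¹ * C).mulVecLin a, w) ∈ outputs A B C D) :
    (a, delay w) ∈ outputs A B C D := by
  obtain ⟨x, u, h, hw⟩ := h
  have h' : Admissible A B (A *ᵥ a + B *ᵥ (-(D⁻¹ *ᵥ (C *ᵥ a)))) x u := by
    convert h using 1
    simp [Matrix.mulVec_mulVec, Matrix.mul_assoc, Matrix.mulVec_neg,
      sub_eq_add_neg]
  refine ⟨_, _, h'.cons, ?_⟩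
  ext1 t
  cases t with
  | zero =>
    simp [delay, Matrix.mulVec_neg, Matrix.mulVec_mulVec, ← Matrix.mul_assoc,
      Matrix.mul_nonsing_inv _ hPCD.isUnit_det]
  | succ t => exact congrFun hw t

theorem StabilizingCompletion.exists_residual_lt (hPCD : StabilizingCompletion A B Q P C D)
    (hAB : Stabilizable A B) (a : Fin n → ℂ) {ε : ℝ} (hε : 0 < ε) :
    ∃ x u, Admissible A B a x u ∧ residual C D x u < ε := by
  have hmem := mem_energyClosure_of_eigenvalues (T := outputs A B C D) hPCD.delay_mem_outputs
    hAB.exists_outputs hPCD.norm_le_one_of_hasEigenvalue a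
  -- Passing from the sup norm to `sqNorm` costs a factor `m`; `m + 1` also covers `m = 0`.
  obtain ⟨w, ⟨x, u, h, hw⟩, hE⟩ := hmem (ε / (m + 1)) (by positivity)
  simp only at hw
  rw [sub_zero] at hE
  refine ⟨x, u, h, ?_⟩
  calc residual C D x u ≤ ∑' t, m * ‖w t‖ ^ 2 := by
        refine h.summable_output.tsum_le_tsum (fun t => ?_) (hE.1.mul_left _)
        rw [hw]
        exact sqNorm_le _
    _ = m * ∑' t, ‖w t‖ ^ 2 := tsum_mul_left
    _ ≤ m * (ε / (m + 1)) := by gcongr; exact hE.2.le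
    _ < ε := by
        rw [mul_div_assoc', div_lt_iff₀ (by positivity)]
        linarith

end Trajectories

end KYP

/-! ### The three claims from `cost = residual - a'Pa`. -/

theorem mainTheorem11 (n m : ℕ)
    (A : Matrix (Fin n) (Fin n) ℂ) (B : Matrix (Fin n) (Fin m) ℂ)
    (Q : Matrix (Fin n ⊕ Fin m) (Fin n ⊕ Fin m) ℂ) (hQ : Q.IsHermitian)
    (hAB : KYP.Stabilizable A B)
    (P : Matrix (Fin n) (Fin n) ℂ) (C : Matrix (Fin m) (Fin n) ℂ)
    (D : Matrix (Fin m) (Fin m) ℂ)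
    (hPCD : KYP.StabilizingCompletion A B Q P C D)
    (a : Fin n → ℂ) :
    -- both series converge along every admissible trajectory
    (∀ (x : ℕ → Fin n → ℂ) (u : ℕ → Fin m → ℂ), KYP.Admissible A B a x u →
      (Summable fun t => KYP.sigma Q (x t) (u t)) ∧
      (Summable fun t => KYP.sqNorm (C.mulVec (x t) + D.mulVec (u t)))) ∧
    -- the infimum of the cost
    IsGLB {r : ℝ | ∃ (x : ℕ → Fin n → ℂ) (u : ℕ → Fin m → ℂ),
      KYP.Admissible A B a x u ∧ KYP.cost Q x u = r} (-KYP.hermForm P a) ∧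
    -- characterization of minimizing sequences
    (∀ (x : ℕ → ℕ → Fin n → ℂ) (u : ℕ → ℕ → Fin m → ℂ),
      (∀ i, KYP.Admissible A B a (x i) (u i)) →
      (Filter.Tendsto (fun i => KYP.residual C D (x i) (u i)) Filter.atTop (nhds 0) ↔
        Filter.Tendsto (fun i => KYP.cost Q (x i) (u i)) Filter.atTop
          (nhds (-KYP.hermForm P a)))) := by
  have hcost : ∀ x u, KYP.Admissible A B a x u →
      KYP.cost Q x u = KYP.residual C D x u - KYP.hermForm P a :=
    fun x u h => (h.hasSum_sigma hPCD).tsum_eq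
  refine ⟨fun x u h => ⟨(h.hasSum_sigma hPCD).summable, h.summable_output⟩, ⟨?_, ?_⟩, ?_⟩
  · rintro r ⟨x, u, h, rfl⟩
    have h0 : 0 ≤ KYP.residual C D x u := tsum_nonneg fun t => KYP.sqNorm_nonneg _
    linarith [hcost x u h]
  · intro r hr
    refine le_of_forall_pos_lt_add fun ε hε => ?_
    obtain ⟨x, u, h, hlt⟩ := hPCD.exists_residual_lt hAB a hε
    linarith [hr ⟨x, u, h, rfl⟩, hcost x u h]
  · intro x u h
    have heq : (fun i => KYP.cost Q (x i) (u i)) =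
        fun i => KYP.residual C D (x i) (u i) + -KYP.hermForm P a :=
      funext fun i => (hcost _ _ (h i)).trans (sub_eq_add_neg _ _)
    rw [heq]
    constructor
    · intro ht
      simpa using ht.add_const (-KYP.hermForm P a)
    · intro ht
      simpa using ht.add_const (KYP.hermForm P a)
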